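/- Let $G$ be a finite-dimensional real (or complex) Lie group. Let $\nabla^0$ be the linear connection on $G$ determined by $\nabla^0_XY=\frac12[X,Y]$ for all left invariant vector fields $X,Y$. For a smooth linear connection $\nabla$ on $G$ write $K^\nabla(X,Y)=\nabla_X\nabla_Y-\nabla_Y\nabla_X-\nabla_{[X,Y]}$ for its curvature. (In the complex case, "smooth" means holomorphic.) Call $\nabla$ \emph{special} if it is torsion free, bi-invariant (that is, invariant under all left multiplications and all right multiplications of $G$), and has the same curvature as $\nabla^0$, i.e. $K^\nabla=K^{\nabla^0}$. Then every special connection $\nabla$ on $G$ is semi-symmetric: it is torsion free, and its curvature tensor field $K=K^\nabla$ satisfies $K\cdot K=0$, i.e. $$\nabla_X\nabla_YK-\nabla_Y\nabla_XK-\nabla_{[X,Y]}K=0$$ for all smooth vector fields $X,Y$ on $G$. Here, for a tensor field $T$ of type $(1,3)$, $$(\nabla_XT)(U,V)W=\nabla_X\big(T(U,V)W\big)-T(\nabla_XU,V)W-T(U,\nabla_XV)W-T(U,V)\nabla_XW .$$ -/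

import Mathlib

open Bundle VectorField
open scoped Manifold ContDiff

noncomputable section

namespace AffineConnection

section Manifold

variable {𝕜 : Type*} [RCLike 𝕜]
  {E : Type*} [NormedAddCommGroup E] [NormedSpace 𝕜 E]
  {H : Type*} [TopologicalSpace H] {I : ModelWithCorners 𝕜 E H}
  {M : Type*} [TopologicalSpace M] [ChartedSpace H M] [IsManifold I ∞ M]

/-- `∇_X Y`, for a linear connection `∇` on `M` and vector fields `X`, `Y`. -/
def nabla (cov : CovariantDerivative I E (TangentSpace I : M → Type _))
    (X Y : Π x : M, TangentSpace I x) : Π x : M, TangentSpace I x :=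
  fun x ↦ cov Y x (X x)

/-- The curvature `K(X, Y)Z = ∇_X ∇_Y Z - ∇_Y ∇_X Z - ∇_{[X, Y]} Z`. -/
def curvature (cov : CovariantDerivative I E (TangentSpace I : M → Type _))
    (X Y Z : Π x : M, TangentSpace I x) : Π x : M, TangentSpace I x :=
  nabla cov X (nabla cov Y Z) - nabla cov Y (nabla cov X Z) - nabla cov (mlieBracket I X Y) Z

/-- The covariant derivative `∇_X T` of a tensor field `T` of type `(1, 3)`, seen as a trilinear
operation on vector fields. -/
def nablaTensor (cov : CovariantDerivative I E (TangentSpace I : M → Type _))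
    (X : Π x : M, TangentSpace I x)
    (T : (Π x : M, TangentSpace I x) → (Π x : M, TangentSpace I x) →
      (Π x : M, TangentSpace I x) → (Π x : M, TangentSpace I x)) :
    (Π x : M, TangentSpace I x) → (Π x : M, TangentSpace I x) →
      (Π x : M, TangentSpace I x) → (Π x : M, TangentSpace I x) :=
  fun U V W ↦ nabla cov X (T U V W) - T (nabla cov X U) V W - T U (nabla cov X V) W
    - T U V (nabla cov X W)

/-- The torsion tensor `T(X, Y) = ∇_X Y - ∇_Y X - [X, Y]` vanishes. -/
def IsTorsionFree [FiniteDimensional 𝕜 E]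
    (cov : CovariantDerivative I E (TangentSpace I : M → Type _)) : Prop :=
  haveI : CompleteSpace E := FiniteDimensional.complete 𝕜 E
  cov.torsion = 0

/-- A linear connection is semi-symmetric if it is torsion free and its curvature `K` satisfies
`∇_X ∇_Y K - ∇_Y ∇_X K - ∇_{[X, Y]} K = 0` for all smooth vector fields `X`, `Y`. -/
structure IsSemiSymmetric [FiniteDimensional 𝕜 E]
    (cov : CovariantDerivative I E (TangentSpace I : M → Type _)) : Prop where
  torsionFree : IsTorsionFree cov
  curvature_dot_curvature : ∀ X Y U V W : Π x : M, TangentSpace I x,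
    CMDiff ∞ (T% X) → CMDiff ∞ (T% Y) →
    CMDiff ∞ (T% U) → CMDiff ∞ (T% V) → CMDiff ∞ (T% W) →
    nablaTensor cov X (nablaTensor cov Y (curvature cov)) U V W
      - nablaTensor cov Y (nablaTensor cov X (curvature cov)) U V W
      - nablaTensor cov (mlieBracket I X Y) (curvature cov) U V W = 0

/-- `φ^*(∇_X Y) = ∇_{φ^* X} (φ^* Y)` for all smooth vector fields `X`, `Y` (used for
diffeomorphisms `φ`). -/
def IsInvariantUnder (cov : CovariantDerivative I E (TangentSpace I : M → Type _))
    (φ : M → M) : Prop :=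
  ∀ X Y : Π x : M, TangentSpace I x, CMDiff ∞ (T% X) → CMDiff ∞ (T% Y) →
    mpullback I I φ (nabla cov X Y) = nabla cov (mpullback I I φ X) (mpullback I I φ Y)

end Manifold

section Algebra

variable {𝕜 : Type*} [RCLike 𝕜] {E : Type*} [NormedAddCommGroup E] [NormedSpace 𝕜 E]

theorem nablaZero_aux_add (L M D D' : E →L[𝕜] E) (B : E →L[𝕜] E →L[𝕜] E) (a a' : E) :
    L ∘L (D + D' + (2⁻¹ : 𝕜) • (B.flip (a + a') ∘L M)) =
      L ∘L (D + (2⁻¹ : 𝕜) • (B.flip a ∘L M)) + L ∘L (D' + (2⁻¹ : 𝕜) • (B.flip a' ∘L M)) := by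
  ext ξ
  simp
  abel

theorem nablaZero_aux_leibniz (L M D : E →L[𝕜] E) (φ : E →L[𝕜] 𝕜) (B : E →L[𝕜] E →L[𝕜] E)
    (a : E) (c : 𝕜) :
    L ∘L (c • D + φ.smulRight a + (2⁻¹ : 𝕜) • (B.flip (c • a) ∘L M)) =
      c • (L ∘L (D + (2⁻¹ : 𝕜) • (B.flip a ∘L M))) + φ.smulRight (L a) := by
  ext ξ
  simp
  module

end Algebra

section Group

variable {𝕜 : Type*} [RCLike 𝕜]
  {E : Type*} [NormedAddCommGroup E] [NormedSpace 𝕜 E]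
  {H : Type*} [TopologicalSpace H] {I : ModelWithCorners 𝕜 E H}
  {G : Type*} [TopologicalSpace G] [ChartedSpace H G] [Group G]
  [LieGroup I ∞ G]

/-- Invariance under left and right multiplications. -/
def IsBiInvariant (cov : CovariantDerivative I E (TangentSpace I : G → Type _)) : Prop :=
  (∀ g : G, IsInvariantUnder cov (fun x ↦ g * x)) ∧
    ∀ g : G, IsInvariantUnder cov (fun x ↦ x * g)

/-- The differential at `1` of the left multiplication by `g`. -/
def leftTransl (g : G) : GroupLieAlgebra I G →L[𝕜] TangentSpace I g :=
  mfderiv I I (fun x ↦ g * x) (1 : G)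

/-- The function `g ↦ (dL_g)⁻¹ (Z g)`, with values in the Lie algebra, for a vector field `Z`. -/
def leftTriv (Z : Π g : G, TangentSpace I g) (g : G) : E :=
  (leftTransl g).inverse (Z g)

theorem lieGroup_minSmoothness : LieGroup I (minSmoothness 𝕜 3) G :=
  LieGroup.of_le (n := ∞) (by
    rw [minSmoothness_of_isRCLikeNormedField]
    exact WithTop.coe_le_coe.2 (le_top : (3 : ℕ∞) ≤ ⊤))

theorem leftTransl_inverse (g : G) : (leftTransl (I := I) g).inverse =
    (mfderiv I I (fun x ↦ g⁻¹ * x) g : E →L[𝕜] E) := by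
  have := lieGroup_minSmoothness (𝕜 := 𝕜) (I := I) (G := G)
  have h : (leftTransl (I := I) g).inverse =
    (mfderiv I I (fun x ↦ g⁻¹ * x) (g * 1) : E →L[𝕜] E) := inverse_mfderiv_mul_left (I := I)
  rw [h, mul_one]

theorem leftTransl_comp_inverse (g : G) (z : TangentSpace I g) :
    leftTransl (I := I) g ((leftTransl (I := I) g).inverse z) = z := by
  have hl : ∀ (h x : G), MDifferentiableAt I I (fun y ↦ h * y) x := fun h x ↦
    (contMDiff_mul_left (I := I) (n := ∞)).mdifferentiable (by simp) x
  have h1 : leftTransl (I := I) g ((leftTransl (I := I) g).inverse z) =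
      ((mfderiv I I (fun x ↦ g * x) (1 : G) : E →L[𝕜] E).comp
        (mfderiv I I (fun x ↦ g⁻¹ * x) g : E →L[𝕜] E)) z := by
    rw [leftTransl_inverse]; rfl
  have h2 := mfderiv_comp (I := I) (I' := I) (I'' := I) g (hl g (g⁻¹ * g)) (hl g⁻¹ g)
  have h3 : ((fun y ↦ g * y) ∘ fun x ↦ g⁻¹ * x) = id := by ext x; simp
  rw [h3, mfderiv_id, inv_mul_cancel] at h2
  rw [h1]
  exact (congrArg (fun L : E →L[𝕜] E ↦ L z) h2).symm

theorem inverse_leftTransl (g : G) :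
    ∀ v : E, (leftTransl (I := I) g).inverse (leftTransl (I := I) g v) = v := by
  intro v
  have hl : ∀ (h x : G), MDifferentiableAt I I (fun y ↦ h * y) x := fun h x ↦
    (contMDiff_mul_left (I := I) (n := ∞)).mdifferentiable (by simp) x
  have h1 : (leftTransl (I := I) g).inverse (leftTransl (I := I) g v) =
      ((mfderiv I I (fun x ↦ g⁻¹ * x) g : E →L[𝕜] E).comp
        (mfderiv I I (fun x ↦ g * x) (1 : G) : E →L[𝕜] E)) v := by
    rw [leftTransl_inverse]; rfl
  have h2 := mfderiv_comp (I := I) (I' := I) (I'' := I) (1 : G) (hl g⁻¹ (g * 1)) (hl g 1)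
  have h3 : ((fun y ↦ g⁻¹ * y) ∘ fun x ↦ g * x) = id := by ext x; simp
  rw [h3, mfderiv_id, mul_one] at h2
  rw [h1]
  exact (congrArg (fun L : E →L[𝕜] E ↦ L v) h2).symm

theorem mdifferentiableAt_leftTriv {Z : Π g : G, TangentSpace I g} {g : G}
    (hZ : MDiffAt (T% Z) g) : MDifferentiableAt I 𝓘(𝕜, E) (leftTriv Z) g := by
  let fg : G → TangentBundle I G := fun h ↦ ⟨h⁻¹, 0⟩
  have sfg : MDiffAt fg g :=
    ((contMDiff_zeroSection 𝕜 (TangentSpace I : G → Type _) (n := ∞)).comp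
      (contMDiff_inv I ∞)).mdifferentiable (by simp) g
  let F₂ : (TangentBundle I G × TangentBundle I G) → TangentBundle (I.prod I) (G × G) :=
    (equivTangentBundleProd I G I G).symm
  have S₂ : MDifferentiable (I.tangent.prod I.tangent) (I.prod I).tangent F₂ :=
    (contMDiff_equivTangentBundleProd_symm (n := ∞)).mdifferentiable (by simp)
  let F₃ : TangentBundle (I.prod I) (G × G) → TangentBundle I G :=
    tangentMap (I.prod I) I (fun p : G × G ↦ p.1 * p.2)
  have S₃ : MDifferentiable (I.prod I).tangent I.tangent F₃ :=
    ((contMDiff_mul I ∞).contMDiff_tangentMap (m := ∞) (by simp)).mdifferentiable (by simp)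
  have S := (S₃ _).comp g ((S₂ _).comp g (sfg.prodMk hZ))
  have key : (F₃ ∘ F₂ ∘ fun h ↦ (fg h, (⟨h, Z h⟩ : TangentBundle I G))) =
      fun h ↦ (⟨1, leftTriv (I := I) (E := E) Z h⟩ : TangentBundle I G) := by
    ext1 h
    have e : (F₃ ∘ F₂ ∘ fun h ↦ (fg h, (⟨h, Z h⟩ : TangentBundle I G))) h =
        ⟨h⁻¹ * h, (mfderiv I I (fun x ↦ h⁻¹ * x) h : E →L[𝕜] E) (Z h)⟩ := by
      simp only [Function.comp_apply, tangentMap, F₃, F₂, fg]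
      refine congrArg (TotalSpace.mk' E (h⁻¹ * h)) ?_
      refine (mfderiv_prod_eq_add_apply
        ((contMDiff_mul I ∞).mdifferentiable (by simp) (h⁻¹, h))).trans ?_
      refine (congrArg₂ (fun a b : E ↦ a + b) (map_zero _) rfl).trans (zero_add _)
    rw [e, leftTriv, leftTransl_inverse, inv_mul_cancel]
  rw [key, mdifferentiableAt_totalSpace] at S
  convert S.2 using 2 with h
  exact (tangentCoordChange_self (mem_extChartAt_source (1 : G))).symm

theorem leftTriv_mulInvariantVectorField (v : E) :
    leftTriv (I := I) (E := E) (mulInvariantVectorField (I := I) (G := G) v) = fun _ : G ↦ v :=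
  funext fun g ↦ inverse_leftTransl g v

variable [FiniteDimensional 𝕜 E]

variable (I G) in
/-- The bracket of the Lie algebra of `G` as a continuous bilinear map. -/
def bracketCLM : E →L[𝕜] E →L[𝕜] E :=
  haveI := lieGroup_minSmoothness (𝕜 := 𝕜) (I := I) (G := G)
  haveI : CompleteSpace E := FiniteDimensional.complete 𝕜 E
  LinearMap.toContinuousBilinearMap (E := E) (F := E) (G := E) (LinearMap.mk₂ 𝕜
    (fun v w : E ↦ (Bracket.bracket : GroupLieAlgebra I G → GroupLieAlgebra I G → _) v w)
    (fun v v' w ↦ add_lie (L := GroupLieAlgebra I G) (M := GroupLieAlgebra I G) v v' w)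
    (fun c v w ↦ smul_lie (R := 𝕜) (L := GroupLieAlgebra I G) (M := GroupLieAlgebra I G) c v w)
    (fun v w w' ↦ lie_add (L := GroupLieAlgebra I G) (M := GroupLieAlgebra I G) v w w')
    (fun c v w ↦ lie_smul (R := 𝕜) (L := GroupLieAlgebra I G) (M := GroupLieAlgebra I G) c v w))

variable (I G) in
/-- The connection `∇⁰`, characterized by `∇⁰_X Y = (1/2) [X, Y]` for left invariant vector fields
`X`, `Y`: for a vector field `Z`, a point `g` and a tangent vector `ξ` at `g`,
`∇⁰_ξ Z = dL_g (dζ_g(ξ) + (1/2) [(dL_g)⁻¹ ξ, ζ(g)])` where `ζ(g) = (dL_g)⁻¹ (Z g)`. -/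
def nablaZero : CovariantDerivative I E (TangentSpace I : G → Type _) where
  toFun Z g := (leftTransl (I := I) g : E →L[𝕜] TangentSpace I g) ∘L
    (mvfderiv I (leftTriv (I := I) Z) g +
      (2⁻¹ : 𝕜) • ((bracketCLM I G).flip (leftTriv (I := I) Z g) ∘L (leftTransl (I := I) g).inverse))
  isCovariantDerivativeOnUniv :=
    { add := by
        intro σ σ' g hσ hσ' _
        have h : leftTriv (I := I) (σ + σ') = leftTriv (I := I) (E := E) σ + leftTriv (I := I) σ' := by
          ext1 h; exact map_add _ _ _
        rw [h, mvfderiv_add (mdifferentiableAt_leftTriv hσ) (mdifferentiableAt_leftTriv hσ')]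
        exact nablaZero_aux_add (E := E) _ _ _ _ _ _ _
      leibniz := by
        intro σ f g hσ hf _
        have h : leftTriv (I := I) (f • σ) = f • leftTriv (I := I) (E := E) σ := by
          ext1 h; exact map_smul _ _ _
        rw [h, mvfderiv_smul hf (mdifferentiableAt_leftTriv hσ)]
        refine (nablaZero_aux_leibniz (E := E) _ _ _ _ _ _ _).trans ?_
        exact congrArg (fun z : E ↦ (_ : E →L[𝕜] E) + ContinuousLinearMap.smulRight (M₁ := E) _ z)
          (leftTransl_comp_inverse g (σ g)) }

/-- The defining property of `∇⁰`. -/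
theorem nablaZero_leftInvariant (u v : GroupLieAlgebra I G) :
    nabla (nablaZero I G) (mulInvariantVectorField u) (mulInvariantVectorField v) =
      (2⁻¹ : 𝕜) • mlieBracket I (mulInvariantVectorField u : Π g : G, TangentSpace I g)
        (mulInvariantVectorField v) := by
  have := lieGroup_minSmoothness (𝕜 := 𝕜) (I := I) (G := G)
  have : CompleteSpace E := FiniteDimensional.complete 𝕜 E
  rw [← mulInvariantVector_mlieBracket]
  ext1 g
  have h : nabla (nablaZero I G) (mulInvariantVectorField u) (mulInvariantVectorField v) g =
      (leftTransl (I := I) g : E →L[𝕜] E) ((mvfderiv I (leftTriv (I := I) (E := E)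
          (mulInvariantVectorField (I := I) (G := G) v)) g : E →L[𝕜] E) (leftTransl (I := I) g u) +
        (2⁻¹ : 𝕜) • bracketCLM I G ((leftTransl (I := I) g).inverse (leftTransl (I := I) g u))
          (leftTriv (I := I) (E := E) (mulInvariantVectorField (I := I) (G := G) v) g)) := rfl
  have hv : (mvfderiv I (leftTriv (I := I) (E := E)
      (mulInvariantVectorField (I := I) (G := G) v)) g : E →L[𝕜] E) = 0 := by
    have h0 : ∀ w : E, mvfderiv I (fun _ : G ↦ w) g = 0 := fun w ↦ mvfderiv_const w
    rw [leftTriv_mulInvariantVectorField (E := E) v]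
    exact h0 v
  have h1 : leftTriv (I := I) (E := E) (mulInvariantVectorField (I := I) (G := G) v) g = v :=
    inverse_leftTransl (E := E) g v
  have h2 := inverse_leftTransl (E := E) (I := I) g u
  rw [h, hv, h1, h2]
  refine (congrArg (leftTransl (I := I) g : E →L[𝕜] E) (zero_add _)).trans ?_
  exact map_smul (leftTransl (I := I) g : E →L[𝕜] E) _ _

/-- A special connection: a torsion free bi-invariant (smooth) linear connection on `G` with the
same curvature as `∇⁰`. -/
structure IsSpecial (cov : CovariantDerivative I E (TangentSpace I : G → Type _)) : Prop where
  smooth : cov.ContMDiffCovariantDerivative ∞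
  torsionFree : IsTorsionFree cov
  biInvariant : IsBiInvariant cov
  curvature_eq : ∀ X Y Z : Π g : G, TangentSpace I g,
    CMDiff ∞ (T% X) → CMDiff ∞ (T% Y) → CMDiff ∞ (T% Z) →
    curvature cov X Y Z = curvature (nablaZero I G) X Y Z

end Group

end AffineConnection

end

noncomputable section

namespace AffineConnection

/-! ### Chain and product rules for vector-valued functions on a manifold -/

section Derivative

variable {𝕜 : Type*} [RCLike 𝕜]
  {E : Type*} [NormedAddCommGroup E] [NormedSpace 𝕜 E]
  {H : Type*} [TopologicalSpace H] {I : ModelWithCorners 𝕜 E H}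
  {M : Type*} [TopologicalSpace M] [ChartedSpace H M]

/-! The Ricci identity turns `K · K` into the algebraic expression `K(X,Y)(K(U,V)W) - K(K(X,Y)U,V)W
- K(U,K(X,Y)V)W - K(U,V)(K(X,Y)W)`, in which the connection enters only through its curvature
(`nablaTensor_comm`). A special connection shares its curvature with `∇⁰`, and there `K(X,Y)Z =
-(1/4) [[X,Y],Z]` for the pointwise Lie algebra bracket (`curvature_nablaZero`). So `K(X,Y)` is a
multiple of `ad [X,Y]`, a derivation of the bracket by Jacobi and hence of the triple product
`[[U,V],W]`; the expression vanishes (`bracketCurvature_derivation`).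

The curvature formula is needed for arbitrary smooth fields, so everything is moved to functions `G
→ E` by left translation. There `∇⁰_X` is the directional derivative along `X` plus half a bracket,
and the derivative terms cancel once `[X,Y]ζ = X(Yζ) - Y(Xζ)` is known for vector-valued `ζ`
(`mvfderiv_mlieBracket_vectorValued`). That identity is extracted from the Jacobi identity for
vector fields. -/

theorem mvfderiv_continuousLinearMap_comp {F F' : Type*} [NormedAddCommGroup F] [NormedSpace 𝕜 F]
    [NormedAddCommGroup F'] [NormedSpace 𝕜 F'] (φ : F →L[𝕜] F') {f : M → F} {x : M}
    (hf : MDifferentiableAt I 𝓘(𝕜, F) f x) (v : TangentSpace I x) :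
    mvfderiv I (fun y ↦ φ (f y)) x v = φ (mvfderiv I f x v) := by
  have h := mfderiv_comp (I := I) (I' := 𝓘(𝕜, F)) (I'' := 𝓘(𝕜, F')) x
    (φ.differentiableAt (x := f x)).mdifferentiableAt hf
  rw [mfderiv_eq_fderiv, φ.fderiv] at h
  exact congrArg (fun L : E →L[𝕜] F' ↦ L v) h

theorem mvfderiv_bilinear {F F' F'' : Type*} [NormedAddCommGroup F] [NormedSpace 𝕜 F]
    [NormedAddCommGroup F'] [NormedSpace 𝕜 F'] [NormedAddCommGroup F''] [NormedSpace 𝕜 F'']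
    (B : F →L[𝕜] F' →L[𝕜] F'') {f : M → F} {f' : M → F'} {x : M}
    (hf : MDifferentiableAt I 𝓘(𝕜, F) f x) (hf' : MDifferentiableAt I 𝓘(𝕜, F') f' x)
    (v : TangentSpace I x) :
    mvfderiv I (fun y ↦ B (f y) (f' y)) x v =
      B (f x) (mvfderiv I f' x v) + B (mvfderiv I f x v) (f' x) := by
  have hB := B.isBoundedBilinearMap
  have h := mfderiv_comp (I := I) (I' := 𝓘(𝕜, F × F')) (I'' := 𝓘(𝕜, F'')) x
    (hB.differentiableAt (f x, f' x)).mdifferentiableAt (hf.prodMk_space hf')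
  rw [mfderiv_eq_fderiv, hB.fderiv] at h
  have h' := congrArg (fun L : E →L[𝕜] F'' ↦ L v) h
  have h₁ := mvfderiv_continuousLinearMap_comp (ContinuousLinearMap.fst 𝕜 F F')
    (hf.prodMk_space hf') v
  have h₂ := mvfderiv_continuousLinearMap_comp (ContinuousLinearMap.snd 𝕜 F F')
    (hf.prodMk_space hf') v
  refine h'.trans (Eq.symm ?_)
  exact congrArg₂ (fun a b ↦ B (f x) b + B a (f' x)) h₁ h₂

end Derivative

/-! ### Lie brackets as commutators of derivations, and the Ricci identity -/

section Manifold

variable {𝕜 : Type*} [RCLike 𝕜]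
  {E : Type*} [NormedAddCommGroup E] [NormedSpace 𝕜 E]
  {H : Type*} [TopologicalSpace H] {I : ModelWithCorners 𝕜 E H}
  {M : Type*} [TopologicalSpace M] [ChartedSpace H M] [IsManifold I ∞ M]
  {F : Type*} [NormedAddCommGroup F] [NormedSpace 𝕜 F]

theorem contMDiff_mvfderiv_apply {f : M → F} {X : Π x : M, TangentSpace I x}
    (hf : ContMDiff I 𝓘(𝕜, F) ∞ f) (hX : CMDiff ∞ (T% X)) :
    ContMDiff I 𝓘(𝕜, F) ∞ (fun x ↦ mvfderiv I f x (X x)) :=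
  (contMDiff_snd_tangentBundle_modelSpace F 𝓘(𝕜, F)).comp
    ((hf.contMDiff_tangentMap (m := ∞) (by simp)).comp hX)

theorem contMDiff_mlieBracket [CompleteSpace E] {X Y : Π x : M, TangentSpace I x}
    (hX : CMDiff ∞ (T% X)) (hY : CMDiff ∞ (T% Y)) : CMDiff ∞ (T% (mlieBracket I X Y)) := by
  intro x
  have : IsManifold I (((⊤ : ℕ∞) : WithTop ℕ∞) + 1) M := by simpa using ‹IsManifold I ∞ M›
  have : IsManifold I (minSmoothness 𝕜 2) M := by
    rw [minSmoothness_of_isRCLikeNormedField]; infer_instance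
  exact (hX x).mlieBracket_vectorField (m := ⊤) (n := ⊤) (hY x)
    (by rw [minSmoothness_of_isRCLikeNormedField]; simp)

/-- `[X, Y] f = X (Y f) - Y (X f)`, wherever there is a nonzero tangent vector. -/
theorem mvfderiv_mlieBracket_smul [CompleteSpace E] {f : M → 𝕜} {X Y Z : Π x : M, TangentSpace I x}
    (hf : ContMDiff I 𝓘(𝕜, 𝕜) ∞ f) (hX : CMDiff ∞ (T% X)) (hY : CMDiff ∞ (T% Y))
    (hZ : CMDiff 2 (T% Z)) (x : M) :
    mvfderiv I f x (mlieBracket I X Y x) • Z x =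
      (mvfderiv I (fun y ↦ mvfderiv I f y (Y y)) x (X x)
        - mvfderiv I (fun y ↦ mvfderiv I f y (X y)) x (Y x)) • Z x := by
  have : IsManifold I (minSmoothness 𝕜 3) M := by
    rw [minSmoothness_of_isRCLikeNormedField]
    exact IsManifold.of_le (n := ∞) (WithTop.coe_le_coe.2 (le_top : (3 : ℕ∞) ≤ ⊤))
  have le2 : minSmoothness 𝕜 2 ≤ ∞ := by
    rw [minSmoothness_of_isRCLikeNormedField]
    exact (WithTop.coe_le_coe.2 (le_top : (2 : ℕ∞) ≤ ⊤))
  have hfd : ∀ y, MDifferentiableAt I 𝓘(𝕜, 𝕜) f y := hf.mdifferentiable (by simp)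
  have hdf {W : Π x : M, TangentSpace I x} (hW : CMDiff ∞ (T% W)) :
    ∀ y, MDifferentiableAt I 𝓘(𝕜, 𝕜) (fun y ↦ mvfderiv I f y (W y)) y :=
    (contMDiff_mvfderiv_apply hf hW).mdifferentiable (by simp)
  have hd {W : Π x : M, TangentSpace I x} (hW : CMDiff ∞ (T% W)) :
    ∀ y, MDiffAt (T% W) y := hW.mdifferentiable (by simp)
  have hZd : ∀ y, MDiffAt (T% Z) y := hZ.mdifferentiable (by simp)
  have hbr {W : Π x : M, TangentSpace I x} (hW : CMDiff ∞ (T% W)) :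
      MDiffAt (T% (mlieBracket I W Z)) x := by
    have : IsManifold I (((2 : ℕ∞) : WithTop ℕ∞) + 1) M := by
      exact IsManifold.of_le (n := ∞) (WithTop.coe_le_coe.2 (le_top : (3 : ℕ∞) ≤ ⊤))
    have : IsManifold I (minSmoothness 𝕜 2) M := IsManifold.of_le (n := ∞) le2
    exact (((hW x).of_le (WithTop.coe_le_coe.2 (le_top : (2 : ℕ∞) ≤ ⊤))).mlieBracket_vectorField
      (m := 1) (n := 2) (hZ x)
      (by rw [minSmoothness_of_isRCLikeNormedField]; norm_num)).mdifferentiableAt (by simp)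
  have h2 : minSmoothness 𝕜 2 ≤ 2 := minSmoothness_of_isRCLikeNormedField.le
  have e {W : Π x : M, TangentSpace I x} : mlieBracket I W (f • Z) =
      (fun y ↦ mvfderiv I f y (W y)) • Z + f • mlieBracket I W Z := by
    ext1 y
    exact mlieBracket_smul_right (hfd y) (hZd y)
  -- Expand Jacobi for `X`, `Y`, `f • Z`. The cross terms `(Xf)[Y,Z]` and `(Yf)[X,Z]` cancel, and
  -- `key0` removes `f` times Jacobi for `Z`; only second derivatives of `f` and `[X,Y]f` remain, as
  -- coefficients of `Z`.
  have key := leibniz_identity_mlieBracket_apply (x := x) ((hX x).of_le le2) ((hY x).of_le le2)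
    ((((hf.of_le (WithTop.coe_le_coe.2 (le_top : (2 : ℕ∞) ≤ ⊤))).smul_section hZ) x).of_le h2)
  have key0 := leibniz_identity_mlieBracket_apply (x := x) ((hX x).of_le le2) ((hY x).of_le le2)
    ((hZ x).of_le h2)
  have ex {W W' : Π x : M, TangentSpace I x} (hW : CMDiff ∞ (T% W)) (hW' : CMDiff ∞ (T% W')) :
      mlieBracket I W' ((fun y ↦ mvfderiv I f y (W y)) • Z + f • mlieBracket I W Z) x =
       (mvfderiv I (fun y ↦ mvfderiv I f y (W y)) x (W' x) • Z x
        + mvfderiv I f x (W x) • mlieBracket I W' Z x) + (mvfderiv I f x (W' x) •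
          mlieBracket I W Z x + f x • mlieBracket I W' (mlieBracket I W Z) x) := by
    rw [mlieBracket_add_right, mlieBracket_smul_right (hdf hW x) (hZd x),
      mlieBracket_smul_right (hfd x) (hbr hW)]
    · exact MDifferentiableAt.smul_section (hdf hW x) (hZd x)
    · exact MDifferentiableAt.smul_section (hfd x) (hbr hW)
  rw [e, e, e, ex hY hX, ex hX hY] at key
  simp only [Pi.add_apply, Pi.smul_apply', key0] at key
  rw [← sub_eq_zero] at key ⊢
  rw [← neg_eq_zero, ← key]
  module

theorem nabla_sub (cov : CovariantDerivative I E (TangentSpace I : M → Type _))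
    {X Y Z : Π x : M, TangentSpace I x} (hY : CMDiff ∞ (T% Y)) (hZ : CMDiff ∞ (T% Z)) :
    nabla cov X (Y - Z) = nabla cov X Y - nabla cov X Z := by
  have hd {W : Π x : M, TangentSpace I x} (hW : CMDiff ∞ (T% W)) :
    ∀ y, MDiffAt (T% W) y := hW.mdifferentiable (by simp)
  ext1 x
  have h := cov.isCovariantDerivativeOnUniv.add (x := x) (hd (hY.sub_section hZ) x) (hd hZ x)
  rw [sub_add_cancel] at h
  have h2 := congrArg (fun L ↦ L (X x)) h
  exact eq_sub_of_add_eq h2.symm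

theorem contMDiff_nabla {cov : CovariantDerivative I E (TangentSpace I : M → Type _)}
    (hcov : cov.ContMDiffCovariantDerivative ∞)
    {X Y : Π x : M, TangentSpace I x} (hX : CMDiff ∞ (T% X)) (hY : CMDiff ∞ (T% Y)) :
    CMDiff ∞ (T% (nabla cov X Y)) := by
  have h := hcov.contMDiff.contMDiff (σ := Y) (by simpa using hY.contMDiffOn)
  rw [contMDiffOn_univ] at h
  exact h.clm_bundle_apply hX

/-- The Ricci identity for a tensor field of type `(1, 3)`. -/
theorem nablaTensor_comm {cov : CovariantDerivative I E (TangentSpace I : M → Type _)}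
    (hcov : cov.ContMDiffCovariantDerivative ∞)
    {T : (Π x : M, TangentSpace I x) → (Π x : M, TangentSpace I x) →
      (Π x : M, TangentSpace I x) → (Π x : M, TangentSpace I x)}
    (hT : ∀ U V W : Π x : M, TangentSpace I x,
      CMDiff ∞ (T% U) → CMDiff ∞ (T% V) → CMDiff ∞ (T% W) → CMDiff ∞ (T% (T U V W)))
    (hT₁ : ∀ U U' V W : Π x : M, TangentSpace I x,
      CMDiff ∞ (T% U) → CMDiff ∞ (T% U') → CMDiff ∞ (T% V) → CMDiff ∞ (T% W) →
      T (U - U') V W = T U V W - T U' V W)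
    (hT₂ : ∀ U V V' W : Π x : M, TangentSpace I x,
      CMDiff ∞ (T% U) → CMDiff ∞ (T% V) → CMDiff ∞ (T% V') → CMDiff ∞ (T% W) →
      T U (V - V') W = T U V W - T U V' W)
    (hT₃ : ∀ U V W W' : Π x : M, TangentSpace I x,
      CMDiff ∞ (T% U) → CMDiff ∞ (T% V) → CMDiff ∞ (T% W) → CMDiff ∞ (T% W') →
      T U V (W - W') = T U V W - T U V W')
    {X Y U V W : Π x : M, TangentSpace I x} (hX : CMDiff ∞ (T% X)) (hY : CMDiff ∞ (T% Y))
    (hXY : CMDiff ∞ (T% (mlieBracket I X Y)))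
    (hU : CMDiff ∞ (T% U)) (hV : CMDiff ∞ (T% V)) (hW : CMDiff ∞ (T% W)) :
    nablaTensor cov X (nablaTensor cov Y T) U V W - nablaTensor cov Y (nablaTensor cov X T) U V W
        - nablaTensor cov (mlieBracket I X Y) T U V W =
      curvature cov X Y (T U V W) - T (curvature cov X Y U) V W - T U (curvature cov X Y V) W
        - T U V (curvature cov X Y W) := by
  have hn {X Y : Π x : M, TangentSpace I x} (hX : CMDiff ∞ (T% X)) (hY : CMDiff ∞ (T% Y)) :=
    contMDiff_nabla hcov hX hY
  have hs {X Y : Π x : M, TangentSpace I x} (hX : CMDiff ∞ (T% X)) (hY : CMDiff ∞ (T% Y)) :=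
    hX.sub_section hY
  have e {X Y : Π x : M, TangentSpace I x} (hX : CMDiff ∞ (T% X)) (hY : CMDiff ∞ (T% Y)) :
      nabla cov X (nabla cov Y (T U V W) - T (nabla cov Y U) V W - T U (nabla cov Y V) W
        - T U V (nabla cov Y W)) = nabla cov X (nabla cov Y (T U V W))
          - nabla cov X (T (nabla cov Y U) V W) - nabla cov X (T U (nabla cov Y V) W)
          - nabla cov X (T U V (nabla cov Y W)) := by
    have h0 := hn hY (hT _ _ _ hU hV hW)
    have h1 := hT _ _ _ (hn hY hU) hV hW
    have h2 := hT _ _ _ hU (hn hY hV) hW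
    have h3 := hT _ _ _ hU hV (hn hY hW)
    rw [nabla_sub cov (hs (hs h0 h1) h2) h3, nabla_sub cov (hs h0 h1) h2, nabla_sub cov h0 h1]
  simp only [nablaTensor, e hX hY, e hY hX, curvature]
  -- Only the curvature terms need splitting inside `T`: mixed terms, with one derivative on an
  -- argument and the other elsewhere, are symmetric in `X` and `Y` and cancel. Hence subtractivity
  -- of `T` on smooth fields suffices.
  rw [hT₁ _ _ _ _ (hs (hn hX (hn hY hU)) (hn hY (hn hX hU))) (hn hXY hU) hV hW,
    hT₁ _ _ _ _ (hn hX (hn hY hU)) (hn hY (hn hX hU)) hV hW,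
    hT₂ _ _ _ _ hU (hs (hn hX (hn hY hV)) (hn hY (hn hX hV))) (hn hXY hV) hW,
    hT₂ _ _ _ _ hU (hn hX (hn hY hV)) (hn hY (hn hX hV)) hW,
    hT₃ _ _ _ _ hU hV (hs (hn hX (hn hY hW)) (hn hY (hn hX hW))) (hn hXY hW),
    hT₃ _ _ _ _ hU hV (hn hX (hn hY hW)) (hn hY (hn hX hW))]
  abel

end Manifold

/-! ### Left trivialization and the curvature of `∇⁰` -/

section Group

variable {𝕜 : Type*} [RCLike 𝕜]
  {E : Type*} [NormedAddCommGroup E] [NormedSpace 𝕜 E]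
  {H : Type*} [TopologicalSpace H] {I : ModelWithCorners 𝕜 E H}
  {G : Type*} [TopologicalSpace G] [ChartedSpace H G] [Group G]
  [LieGroup I ∞ G]

/-- The value at `h` is the differential of multiplication at `(h⁻¹, h)` applied to `(0, Z h)`: a
tangent map composed with a smooth section, landing in the fibre over `1`. -/
theorem contMDiff_leftTriv {Z : Π g : G, TangentSpace I g} (hZ : CMDiff ∞ (T% Z)) :
    ContMDiff I 𝓘(𝕜, E) ∞ (leftTriv Z) := by
  let fg : G → TangentBundle I G := fun h ↦ ⟨h⁻¹, 0⟩
  have sfg : CMDiff ∞ fg :=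
    (contMDiff_zeroSection 𝕜 (TangentSpace I : G → Type _) (n := ∞)).comp (contMDiff_inv I ∞)
  let F₂ : (TangentBundle I G × TangentBundle I G) → TangentBundle (I.prod I) (G × G) :=
    (equivTangentBundleProd I G I G).symm
  have S₂ : ContMDiff (I.tangent.prod I.tangent) (I.prod I).tangent ∞ F₂ :=
    contMDiff_equivTangentBundleProd_symm
  let F₃ : TangentBundle (I.prod I) (G × G) → TangentBundle I G :=
    tangentMap (I.prod I) I (fun p : G × G ↦ p.1 * p.2)
  have S₃ : ContMDiff (I.prod I).tangent I.tangent ∞ F₃ :=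
    (contMDiff_mul I ∞).contMDiff_tangentMap (m := ∞) (by simp)
  have S := S₃.comp (S₂.comp (sfg.prodMk hZ))
  have key : (F₃ ∘ F₂ ∘ fun h ↦ (fg h, (⟨h, Z h⟩ : TangentBundle I G))) =
      fun h ↦ (⟨1, leftTriv (I := I) (E := E) Z h⟩ : TangentBundle I G) := by
    ext1 h
    have e : (F₃ ∘ F₂ ∘ fun h ↦ (fg h, (⟨h, Z h⟩ : TangentBundle I G))) h =
        ⟨h⁻¹ * h, (mfderiv I I (fun x ↦ h⁻¹ * x) h : E →L[𝕜] E) (Z h)⟩ := by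
      simp only [Function.comp_apply, tangentMap, F₃, F₂, fg]
      refine congrArg (TotalSpace.mk' E (h⁻¹ * h)) ?_
      refine (mfderiv_prod_eq_add_apply
        ((contMDiff_mul I ∞).mdifferentiable (by simp) (h⁻¹, h))).trans ?_
      refine (congrArg₂ (fun a b : E ↦ a + b) (map_zero _) rfl).trans (zero_add _)
    rw [e, leftTriv, leftTransl_inverse, inv_mul_cancel]
  rw [key] at S
  intro g
  have Sg := (contMDiffAt_totalSpace.1 (S g)).2
  convert Sg using 2 with h
  exact (tangentCoordChange_self (mem_extChartAt_source (1 : G))).symm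

/-- Supplies the auxiliary field `Z` in `mvfderiv_mlieBracket_smul`, with any prescribed vector `v`
at the identity. -/
theorem contMDiff_two_mulInvariantVectorField (v : GroupLieAlgebra I G) :
    CMDiff 2 (T% (mulInvariantVectorField v : Π g : G, TangentSpace I g)) := by
  have := lieGroup_minSmoothness (𝕜 := 𝕜) (I := I) (G := G)
  exact (contMDiff_mulInvariantVectorField v).of_le le_minSmoothness

theorem leftTriv_injective {X Y : Π g : G, TangentSpace I g} {g : G}
    (h : leftTriv (I := I) (E := E) X g = leftTriv (I := I) Y g) : X g = Y g := by
  rw [← leftTransl_comp_inverse (I := I) g (X g), ← leftTransl_comp_inverse (I := I) g (Y g)]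
  exact congrArg (leftTransl (I := I) g : E →L[𝕜] E) h

/-- `[X, Y] f = X (Y f) - Y (X f)` for a smooth scalar function `f` on a Lie group, multiplied by a
vector `v` so that the case of a trivial Lie algebra is included. -/
theorem mvfderiv_mlieBracket_smul_vector [FiniteDimensional 𝕜 E] {f : G → 𝕜} {X Y : Π g : G, TangentSpace I g}
    (hf : ContMDiff I 𝓘(𝕜, 𝕜) ∞ f) (hX : CMDiff ∞ (T% X)) (hY : CMDiff ∞ (T% Y)) (g : G) (v : E) :
    mvfderiv I f g (mlieBracket I X Y g) • v =
      (mvfderiv I (fun y ↦ mvfderiv I f y (Y y)) g (X g)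
        - mvfderiv I (fun y ↦ mvfderiv I f y (X y)) g (Y g)) • v := by
  have : CompleteSpace E := FiniteDimensional.complete 𝕜 E
  have h := mvfderiv_mlieBracket_smul hf hX hY
    (contMDiff_two_mulInvariantVectorField (I := I) (G := G) v) g
  have h' := congrArg (leftTransl (I := I) g).inverse h
  rw [map_smul, map_smul] at h'
  have e : (leftTransl (I := I) g).inverse
    (mulInvariantVectorField (I := I) (G := G) v g) = v := inverse_leftTransl (E := E) g v
  rw [e] at h'
  exact h'

/-- `[X, Y] ζ = X (Y ζ) - Y (X ζ)` for a smooth vector-valued function `ζ` on a Lie group. -/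
theorem mvfderiv_mlieBracket_vectorValued [FiniteDimensional 𝕜 E] {f : G → E}
    {X Y : Π g : G, TangentSpace I g}
    (hf : ContMDiff I 𝓘(𝕜, E) ∞ f) (hX : CMDiff ∞ (T% X)) (hY : CMDiff ∞ (T% Y)) (g : G) :
    mvfderiv I f g (mlieBracket I X Y g) =
      mvfderiv I (fun y ↦ mvfderiv I f y (Y y)) g (X g)
        - mvfderiv I (fun y ↦ mvfderiv I f y (X y)) g (Y g) := by
  rw [← sub_eq_zero]
  set D := mvfderiv I f g (mlieBracket I X Y g) -
    (mvfderiv I (fun y ↦ mvfderiv I f y (Y y)) g (X g)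
        - mvfderiv I (fun y ↦ mvfderiv I f y (X y)) g (Y g)) with hD
  -- The scalar identity is multiplied by the defect `D` itself: were `D` nonzero, every functional
  -- would kill it, but functionals separate points.
  have key (φ : E →L[𝕜] 𝕜) : φ D • D = 0 := by
    have h := mvfderiv_mlieBracket_smul_vector (φ.contMDiff.comp hf) hX hY g D
    have e (y : G) (v : TangentSpace I y) : mvfderiv I (φ ∘ f) y v = φ (mvfderiv I f y v) :=
      mvfderiv_continuousLinearMap_comp φ (hf.mdifferentiable (by simp) y) v
    have hd {W : Π g : G, TangentSpace I g} (hW : CMDiff ∞ (T% W)) :=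
      (contMDiff_mvfderiv_apply hf hW).mdifferentiable (by simp) g
    simp only [e] at h
    rw [mvfderiv_continuousLinearMap_comp φ (hd hX), mvfderiv_continuousLinearMap_comp φ (hd hY),
      ← sub_eq_zero, ← sub_smul, ← map_sub, ← map_sub] at h
    exact h
  by_contra hne
  refine hne ((Module.forall_dual_apply_eq_zero_iff 𝕜 D).1 fun φ ↦ ?_)
  exact (smul_eq_zero.1 (key φ.toContinuousLinearMap)).resolve_right hne

variable [FiniteDimensional 𝕜 E]

theorem bracketCLM_swap (x y : E) : bracketCLM I G x y = - bracketCLM I G y x := by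
  have := lieGroup_minSmoothness (𝕜 := 𝕜) (I := I) (G := G)
  have : CompleteSpace E := FiniteDimensional.complete 𝕜 E
  exact (lie_skew (L := GroupLieAlgebra I G) x y).symm

theorem bracketCLM_jacobi (x y z : E) : bracketCLM I G x (bracketCLM I G y z) =
    bracketCLM I G (bracketCLM I G x y) z + bracketCLM I G y (bracketCLM I G x z) := by
  have := lieGroup_minSmoothness (𝕜 := 𝕜) (I := I) (G := G)
  have : CompleteSpace E := FiniteDimensional.complete 𝕜 E
  exact leibniz_lie (M := GroupLieAlgebra I G) (L₁ := GroupLieAlgebra I G) (L₂ := GroupLieAlgebra I G) x y z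

theorem leftTriv_nablaZero (X Z : Π g : G, TangentSpace I g) :
    leftTriv (I := I) (nabla (nablaZero I G) X Z) = fun g ↦
      mvfderiv I (leftTriv (I := I) (E := E) Z) g (X g) +
      (2⁻¹ : 𝕜) • bracketCLM I G (leftTriv (I := I) X g) (leftTriv (I := I) Z g) :=
  funext fun g ↦ inverse_leftTransl (I := I) (E := E) g _

/-- Torsion is tensorial, so it can be tested on left invariant fields through the given vectors,
where `(1/2)[X,Y] - (1/2)[Y,X] = [X,Y]`. -/
theorem isTorsionFree_nablaZero : IsTorsionFree (nablaZero I G) := by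
  have := lieGroup_minSmoothness (𝕜 := 𝕜) (I := I) (G := G)
  have : CompleteSpace E := FiniteDimensional.complete 𝕜 E
  unfold IsTorsionFree
  ext g u v
  have hu : mulInvariantVectorField (I := I) (G := G) ((leftTransl (I := I) g).inverse u) g = u :=
    leftTransl_comp_inverse g u
  have hv : mulInvariantVectorField (I := I) (G := G) ((leftTransl (I := I) g).inverse v) g = v :=
    leftTransl_comp_inverse g v
  have h := CovariantDerivative.torsion_apply (nablaZero I G)
    (mdifferentiableAt_mulInvariantVectorField (I := I) ((leftTransl (I := I) g).inverse u) (g := g))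
    (mdifferentiableAt_mulInvariantVectorField (I := I) ((leftTransl (I := I) g).inverse v) (g := g))
  have h1 := fun u v ↦ congrFun (nablaZero_leftInvariant (I := I) (G := G) u v) g
  simp only [nabla] at h1
  rw [h1, h1, mlieBracket_swap (V := mulInvariantVectorField (I := I) (G := G)
    ((leftTransl (I := I) g).inverse v)), hu, hv] at h
  refine h.trans ?_
  have h2 (a : E) : (2⁻¹ : 𝕜) • a - (2⁻¹ : 𝕜) • (-a) - a = 0 := by module
  exact h2 _

/-- Torsion freeness gives `[X,Y] = ∇⁰_X Y - ∇⁰_Y X`; the two half brackets add up by antisymmetry.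
-/
theorem leftTriv_mlieBracket {X Y : Π g : G, TangentSpace I g}
    (hX : CMDiff ∞ (T% X)) (hY : CMDiff ∞ (T% Y)) (g : G) :
    leftTriv (I := I) (mlieBracket I X Y) g =
      mvfderiv I (leftTriv (I := I) (E := E) Y) g (X g)
       - mvfderiv I (leftTriv (I := I) (E := E) X) g (Y g)
       + bracketCLM I G (leftTriv (I := I) X g) (leftTriv (I := I) Y g) := by
  have : CompleteSpace E := FiniteDimensional.complete 𝕜 E
  have h := (CovariantDerivative.torsion_eq_zero_iff (nablaZero I G)).1 isTorsionFree_nablaZero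
    (hX.mdifferentiable (by simp) g) (hY.mdifferentiable (by simp) g)
  have h1 := congrFun (leftTriv_nablaZero X Y) g
  have h2 := congrFun (leftTriv_nablaZero Y X) g
  have h3 : leftTriv (I := I) (mlieBracket I X Y) g = leftTriv (I := I) (nabla (nablaZero I G) X Y) g
    - leftTriv (I := I) (nabla (nablaZero I G) Y X) g := by
    refine (congrArg (leftTransl (I := I) g).inverse h.symm).trans ?_
    exact map_sub (leftTransl (I := I) g).inverse _ _
  rw [h3, h1, h2, bracketCLM_swap (leftTriv (I := I) Y g)]
  module

/-- With `ξ`, `η`, `ζ` the trivialized fields, all derivative terms cancel. What is left is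
`(1/4)([ξ,[η,ζ]] - [η,[ξ,ζ]]) - (1/2)[[ξ,η],ζ]`, and Jacobi makes the coefficient `1/4 - 1/2`. -/
theorem leftTriv_curvature_nablaZero {X Y Z : Π g : G, TangentSpace I g}
    (hX : CMDiff ∞ (T% X)) (hY : CMDiff ∞ (T% Y)) (hZ : CMDiff ∞ (T% Z)) (g : G) :
    leftTriv (I := I) (curvature (nablaZero I G) X Y Z) g =
      -(4⁻¹ : 𝕜) • bracketCLM I G
        (bracketCLM I G (leftTriv (I := I) X g) (leftTriv (I := I) Y g)) (leftTriv (I := I) Z g) := by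
  have ht {W : Π g : G, TangentSpace I g} (hW : CMDiff ∞ (T% W)) :
      ∀ g, MDifferentiableAt I 𝓘(𝕜, E) (leftTriv (I := I) W) g :=
    (contMDiff_leftTriv hW).mdifferentiable (by simp)
  have hd {W : Π g : G, TangentSpace I g} (hW : CMDiff ∞ (T% W)) :
      MDifferentiableAt I 𝓘(𝕜, E) (fun y ↦ mvfderiv I (leftTriv (I := I) (E := E) Z) y (W y)) g :=
    (contMDiff_mvfderiv_apply (contMDiff_leftTriv hZ) hW).mdifferentiable (by simp) g
  have hb {W : Π g : G, TangentSpace I g} (hW : CMDiff ∞ (T% W)) :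
      MDifferentiableAt I 𝓘(𝕜, E) (fun y ↦ bracketCLM I G (leftTriv (I := I) W y) (leftTriv (I := I) Z y)) g :=
    ((bracketCLM I G).contMDiff.comp (contMDiff_leftTriv hW)).clm_apply (contMDiff_leftTriv hZ)
      |>.mdifferentiable (by simp) g
  have hc (V W : Π g : G, TangentSpace I g) (hW : CMDiff ∞ (T% W)) :
     leftTriv (I := I) (nabla (nablaZero I G) V (nabla (nablaZero I G) W Z)) g =
      mvfderiv I (fun y ↦ mvfderiv I (leftTriv (I := I) (E := E) Z) y (W y)) g (V g)
      + (2⁻¹ : 𝕜) • (bracketCLM I G (leftTriv (I := I) W g) (mvfderiv I (leftTriv (I := I) (E := E) Z) g (V g))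
        + bracketCLM I G (mvfderiv I (leftTriv (I := I) (E := E) W) g (V g)) (leftTriv (I := I) Z g))
      + (2⁻¹ : 𝕜) • bracketCLM I G (leftTriv (I := I) V g)
        (mvfderiv I (leftTriv (I := I) (E := E) Z) g (W g) + (2⁻¹ : 𝕜) •
          bracketCLM I G (leftTriv (I := I) W g) (leftTriv (I := I) Z g)) := by
    rw [leftTriv_nablaZero V, leftTriv_nablaZero W]
    beta_reduce
    have h1 := mvfderiv_add (hd hW) ((hb hW).const_smul (2⁻¹ : 𝕜))
    have h2 := mvfderiv_continuousLinearMap_comp ((2⁻¹ : 𝕜) • ContinuousLinearMap.id 𝕜 E) (hb hW) (V g)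
    rw [mvfderiv_bilinear _ (ht hW g) (ht hZ g)] at h2
    have h1' := congrArg (fun L : E →L[𝕜] E ↦ L (V g)) h1
    refine congrArg (· + _) (h1'.trans ?_)
    exact congrArg (_ + ·) h2
  have h3 : leftTriv (I := I) (curvature (nablaZero I G) X Y Z) g =
      leftTriv (I := I) (nabla (nablaZero I G) X (nabla (nablaZero I G) Y Z)) g
      - leftTriv (I := I) (nabla (nablaZero I G) Y (nabla (nablaZero I G) X Z)) g
      - leftTriv (I := I) (nabla (nablaZero I G) (mlieBracket I X Y) Z) g :=
    (map_sub (leftTransl (I := I) g).inverse _ _).trans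
      (congrArg₂ (fun a b : E ↦ a - b) (map_sub (leftTransl (I := I) g).inverse _ _) rfl)
  rw [h3, hc X Y hY, hc Y X hX, leftTriv_nablaZero (mlieBracket I X Y)]
  beta_reduce
  rw [leftTriv_mlieBracket hX hY,
    mvfderiv_mlieBracket_vectorValued (contMDiff_leftTriv hZ) hX hY]
  simp only [map_add, map_sub, map_smul, _root_.add_apply, _root_.sub_apply]
  rw [bracketCLM_jacobi (leftTriv (I := I) X g)]
  module

/-- The tensor field `-(1/4) [[X, Y], Z]`. -/
def bracketCurvature (X Y Z : Π g : G, TangentSpace I g) : Π g : G, TangentSpace I g := fun g ↦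
  leftTransl (I := I) g (-(4⁻¹ : 𝕜) • bracketCLM I G
        (bracketCLM I G (leftTriv (I := I) X g) (leftTriv (I := I) Y g)) (leftTriv (I := I) Z g) : E)

theorem leftTriv_bracketCurvature (X Y Z : Π g : G, TangentSpace I g) (g : G) :
    leftTriv (I := I) (bracketCurvature X Y Z) g =
      -(4⁻¹ : 𝕜) • bracketCLM I G
        (bracketCLM I G (leftTriv (I := I) X g) (leftTriv (I := I) Y g)) (leftTriv (I := I) Z g) := inverse_leftTransl (I := I) (E := E) g _

omit [LieGroup I ∞ G] [FiniteDimensional 𝕜 E] in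
theorem leftTriv_sub (X Y : Π g : G, TangentSpace I g) (g : G) :
    leftTriv (I := I) (E := E) (X - Y) g = leftTriv (I := I) X g - leftTriv (I := I) Y g :=
  map_sub (leftTransl (I := I) g).inverse _ _

theorem curvature_nablaZero {X Y Z : Π g : G, TangentSpace I g}
    (hX : CMDiff ∞ (T% X)) (hY : CMDiff ∞ (T% Y)) (hZ : CMDiff ∞ (T% Z)) :
    curvature (nablaZero I G) X Y Z = bracketCurvature X Y Z :=
  funext fun g ↦ leftTriv_injective <| by
    rw [leftTriv_curvature_nablaZero hX hY hZ, leftTriv_bracketCurvature]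

/-- `-(1/4) [[X, Y], ·]` acts as a derivation on `-(1/4) [[U, V], W]`. -/
theorem bracketCurvature_derivation (X Y U V W : Π g : G, TangentSpace I g) :
    bracketCurvature X Y (bracketCurvature U V W) - bracketCurvature (bracketCurvature X Y U) V W
      - bracketCurvature U (bracketCurvature X Y V) W
      - bracketCurvature U V (bracketCurvature X Y W) = 0 := by
  rw [sub_sub, sub_sub, sub_eq_zero]
  refine funext fun g ↦ leftTriv_injective ?_
  have ha (X Y : Π g : G, TangentSpace I g) :
      leftTriv (I := I) (E := E) (X + Y) g = leftTriv (I := I) X g + leftTriv (I := I) Y g :=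
    map_add (leftTransl (I := I) g).inverse _ _
  simp only [ha, leftTriv_bracketCurvature, map_smul, _root_.smul_apply]
  -- The first use moves `ad [x,y]` past the outer bracket of `[[u,v],w]`, the second past the inner
  -- one.
  rw [bracketCLM_jacobi (bracketCLM I G _ _), bracketCLM_jacobi (bracketCLM I G _ _)]
  simp only [map_add, _root_.add_apply]
  module

theorem bracketCurvature_sub_left
    (U U' V W : Π g : G, TangentSpace I g) :
    bracketCurvature (U - U') V W = bracketCurvature U V W - bracketCurvature U' V W :=
  funext fun g ↦ leftTriv_injective <| by
    simp only [leftTriv_sub, leftTriv_bracketCurvature, map_sub, _root_.sub_apply, smul_sub]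

theorem bracketCurvature_sub_mid
    (U V V' W : Π g : G, TangentSpace I g) :
    bracketCurvature U (V - V') W = bracketCurvature U V W - bracketCurvature U V' W :=
  funext fun g ↦ leftTriv_injective <| by
    simp only [leftTriv_sub, leftTriv_bracketCurvature, map_sub, _root_.sub_apply, smul_sub]

theorem bracketCurvature_sub_right
    (U V W W' : Π g : G, TangentSpace I g) :
    bracketCurvature U V (W - W') = bracketCurvature U V W - bracketCurvature U V W' :=
  funext fun g ↦ leftTriv_injective <| by
    simp only [leftTriv_sub, leftTriv_bracketCurvature, map_sub, smul_sub]

end Group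

end AffineConnection

end

theorem mainTheorem11 {𝕜 : Type*} [RCLike 𝕜]
    {E : Type*} [NormedAddCommGroup E] [NormedSpace 𝕜 E] [FiniteDimensional 𝕜 E]
    {H : Type*} [TopologicalSpace H] {I : ModelWithCorners 𝕜 E H} [I.Boundaryless]
    {G : Type*} [TopologicalSpace G] [ChartedSpace H G] [Group G] [LieGroup I ∞ G]
    (cov : CovariantDerivative I E (TangentSpace I : G → Type _))
    (hcov : AffineConnection.IsSpecial cov) :
    AffineConnection.IsSemiSymmetric cov := by
  open AffineConnection in
  have : CompleteSpace E := FiniteDimensional.complete 𝕜 E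
  refine ⟨hcov.torsionFree, fun X Y U V W hX hY hU hV hW ↦ ?_⟩
  have hK {U V W : Π g : G, TangentSpace I g} (hU : CMDiff ∞ (T% U)) (hV : CMDiff ∞ (T% V))
      (hW : CMDiff ∞ (T% W)) : curvature cov U V W = bracketCurvature U V W :=
    (hcov.curvature_eq U V W hU hV hW).trans (curvature_nablaZero hU hV hW)
  have hn {X Y : Π g : G, TangentSpace I g} (hX : CMDiff ∞ (T% X)) (hY : CMDiff ∞ (T% Y)) :=
    contMDiff_nabla hcov.smooth hX hY
  have hs {U V W : Π g : G, TangentSpace I g} (hU : CMDiff ∞ (T% U)) (hV : CMDiff ∞ (T% V))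
      (hW : CMDiff ∞ (T% W)) : CMDiff ∞ (T% (curvature cov U V W)) :=
    ((hn hU (hn hV hW)).sub_section (hn hV (hn hU hW))).sub_section
      (hn (contMDiff_mlieBracket hU hV) hW)
  rw [nablaTensor_comm hcov.smooth (fun _ _ _ ↦ hs) ?_ ?_ ?_ hX hY (contMDiff_mlieBracket hX hY)
    hU hV hW]
  -- Outer curvatures are replaced first, while the inner ones are still `curvature cov`, whose
  -- smoothness is `hs`.
  · rw [hK hX hY (hs hU hV hW), hK (hs hX hY hU) hV hW, hK hU (hs hX hY hV) hW,
      hK hU hV (hs hX hY hW), hK hU hV hW, hK hX hY hU, hK hX hY hV, hK hX hY hW]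
    exact bracketCurvature_derivation X Y U V W
  -- Subtractivity of the curvature is read off from its algebraic formula on smooth fields.
  · intro U U' V W hU hU' hV hW
    rw [hK (hU.sub_section hU') hV hW, hK hU hV hW, hK hU' hV hW, bracketCurvature_sub_left]
  · intro U V V' W hU hV hV' hW
    rw [hK hU (hV.sub_section hV') hW, hK hU hV hW, hK hU hV' hW, bracketCurvature_sub_mid]
  · intro U V W W' hU hV hW hW'
    rw [hK hU hV (hW.sub_section hW'), hK hU hV hW, hK hU hV hW', bracketCurvature_sub_right]
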